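/- Notation. Let $\mathbb D=\{p=p_{st}+p_{\mathcal I}\epsilon : p_{st},p_{\mathcal I}\in\mathbb R\}$ be the dual numbers and $\mathbb{DQ}=\{q=q_{st}+q_{\mathcal I}\epsilon : q_{st},q_{\mathcal I}\in\mathbb H\}$ the dual quaternions ($\mathbb H$ the real quaternions), where $\epsilon$ is central and $\epsilon^2=0$. Regard $\mathbb D\subset\mathbb{DQ}$. The conjugate of $q$ is $q^*=q_{st}^*+q_{\mathcal I}^*\epsilon$, and $*$ on vectors and matrices is the conjugate transpose. The total order on $\mathbb D$ is: $p\le q$ iff $p_{st}<q_{st}$, or $p_{st}=q_{st}$ and $p_{\mathcal I}\le q_{\mathcal I}$. A dual number is appreciable if its standard part $p_{st}$ is nonzero; a vector $\mathbf x\in\mathbb{DQ}^n$ is appreciable if the standard part of at least one component is nonzero. For $A\in\mathbb{DQ}^{n\times n}$, $\lambda\in\mathbb{DQ}$ is a right eigenvalue of $A$, with eigenvector $\mathbf x$, if $\mathbf x$ is appreciable and $A\mathbf x=\mathbf x\lambda$; it is called an eigenvalue if moreover $\lambda\in\mathbb D$. The multiplicity of $d\in\mathbb D$ as an eigenvalue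 of $A$ is the largest number of eigenvectors associated with $d$ that are right linearly independent over $\mathbb{DQ}$. A Hermitian $A$ (i.e. $A^*=A$; then $\mathbf x^*A\mathbf x\in\mathbb D$ for all $\mathbf x$) is positive semidefinite if $\mathbf x^*A\mathbf x\ge 0$ for all $\mathbf x\in\mathbb{DQ}^n$, and positive definite if $\mathbf x^*A\mathbf x$ is positive and appreciable for all appreciable $\mathbf x\in\mathbb{DQ}^n$. Theorem. Let $A\in\mathbb{DQ}^{n\times n}$ be Hermitian. Then $A$ has exactly $n$ eigenvalues counted with multiplicity, and these are its only right eigenvalues: there are dual numbers $\sigma_1\ge\sigma_2\ge\cdots\ge\sigma_n$ such that the set of right eigenvalues of $A$ in $\mathbb{DQ}$ is $\{\sigma_1,\dots,\sigma_n\}$ and every $d\in\mathbb D$ occurs in the list $\sigma_1,\dots,\sigma_n$ exactly as often as its multiplicity as an eigenvalue of $A$ (zero times if it is not an eigenvalue). There are $n$ eigenvectors $\mathbf u_1,\dots,\mathbf u_n\in\mathbb{DQ}^n$ associated with these eigenvalues, $A\mathbf u_i=\mathbf u_i\sigma_i$, which can be chosen orthonormal, $\mathbf u_i^*\mathbf u_j=\delta_{ij}$.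 Moreover, $A$ is positive semidefinite if and only if $\sigma_i\ge 0$ for all $i$, and $A$ is positive definite if and only if every $\sigma_i$ is positive and appreciable. -/

import Mathlib

open scoped Quaternion Matrix

/-- Dual numbers `q = q_st + q_I ε` over the reals; `fst` is the standard part and `snd` is the
infinitesimal part. -/
abbrev DualReal : Type := DualNumber ℝ

/-- Dual quaternions `q = q_st + q_I ε` with `q_st`, `q_I` real quaternions and `ε` central,
`ε ^ 2 = 0`. -/
abbrev DualQuaternion : Type := DualNumber ℍ[ℝ]

namespace DualReal

/-- The total (lexicographic) order on dual numbers: `p ≤ q` iff `p_st < q_st`, or `p_st = q_st` and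
`p_I ≤ q_I`. -/
noncomputable instance instLinearOrder : LinearOrder DualReal where
  le p q := p.fst < q.fst ∨ (p.fst = q.fst ∧ p.snd ≤ q.snd)
  le_refl p := Or.inr ⟨rfl, le_refl _⟩
  le_trans p q r := by
    rintro (h | ⟨h, h'⟩) (k | ⟨k, k'⟩)
    · exact Or.inl (h.trans k)
    · exact Or.inl (k ▸ h)
    · exact Or.inl (h ▸ k)
    · exact Or.inr ⟨h.trans k, h'.trans k'⟩
  le_antisymm p q := by
    rintro (h | ⟨h, h'⟩) (k | ⟨k, k'⟩)
    · exact absurd (h.trans k) (lt_irrefl _)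
    · exact absurd h (k ▸ lt_irrefl _)
    · exact absurd k (h ▸ lt_irrefl _)
    · exact TrivSqZeroExt.ext h (le_antisymm h' k')
  le_total p q := by
    rcases lt_trichotomy p.fst q.fst with h | h | h
    · exact Or.inl (Or.inl h)
    · rcases le_total p.snd q.snd with k | k
      · exact Or.inl (Or.inr ⟨h, k⟩)
      · exact Or.inr (Or.inr ⟨h.symm, k⟩)
    · exact Or.inr (Or.inl h)
  toDecidableLE := Classical.decRel _

/-- A dual number is appreciable if its standard part is nonzero. -/
def Appreciable (p : DualReal) : Prop := p.fst ≠ 0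

end DualReal

namespace DualQuaternion

/-- Conjugation of dual quaternions: `q* = q_st* + q_I* ε`. -/
noncomputable instance instStarRing : StarRing DualQuaternion where
  star q := TrivSqZeroExt.inl (star q.fst) + TrivSqZeroExt.inr (star q.snd)
  star_involutive q := by ext <;> simp
  star_mul p q := by
    apply TrivSqZeroExt.ext
    · simp
    · simp [add_comm]
  star_add p q := by
    apply TrivSqZeroExt.ext <;> simp

/-- A dual number regarded as a dual quaternion. -/
noncomputable def ofDual (p : DualReal) : DualQuaternion :=
  TrivSqZeroExt.inl (p.fst : ℍ[ℝ]) + TrivSqZeroExt.inr (p.snd : ℍ[ℝ])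

/-- A dual quaternion vector is appreciable if the standard part of some component is nonzero. -/
def AppreciableVec {n : ℕ} (x : Fin n → DualQuaternion) : Prop := ∃ i, (x i).fst ≠ 0

/-- `x` is a right eigenvector of `A` associated with `l`: `x` is appreciable and `A x = x l`. -/
def IsRightEigenvector {n : ℕ} (A : Matrix (Fin n) (Fin n) DualQuaternion) (l : DualQuaternion)
    (x : Fin n → DualQuaternion) : Prop :=
  AppreciableVec x ∧ A *ᵥ x = fun i => x i * l

/-- Right eigenvalues, a priori arbitrary dual quaternions. -/
def IsRightEigenvalue {n : ℕ} (A : Matrix (Fin n) (Fin n) DualQuaternion)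
    (l : DualQuaternion) : Prop :=
  ∃ x, IsRightEigenvector A l x

/-- `x` is an eigenvector of `A` associated with the dual number `d`. -/
def IsEigenvector {n : ℕ} (A : Matrix (Fin n) (Fin n) DualQuaternion) (d : DualReal)
    (x : Fin n → DualQuaternion) : Prop :=
  IsRightEigenvector A (ofDual d) x

/-- The dual number `d` has multiplicity `m` as an eigenvalue of `A`: `m` is the largest number
of eigenvectors associated with `d` that are linearly independent over the dual quaternions, which
act on vectors by multiplication from the right. It is `0` iff `d` is not an eigenvalue. -/
def HasMultiplicity {n : ℕ} (A : Matrix (Fin n) (Fin n) DualQuaternion) (d : DualReal)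
    (m : ℕ) : Prop :=
  IsGreatest {k : ℕ | ∃ v : Fin k → (Fin n → DualQuaternion),
    LinearIndependent DualQuaternionᵐᵒᵖ v ∧ ∀ j, IsEigenvector A d (v j)} m

/-- `A` is positive semidefinite: `A` is Hermitian and for every vector `x` the value `x* A x`,
which is a dual number, is `≥ 0`. -/
def IsPosSemidef {n : ℕ} (A : Matrix (Fin n) (Fin n) DualQuaternion) : Prop :=
  A.IsHermitian ∧ ∀ x : Fin n → DualQuaternion,
    ∃ d : DualReal, star x ⬝ᵥ (A *ᵥ x) = ofDual d ∧ 0 ≤ d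

/-- `A` is positive definite: `A` is Hermitian and for every appreciable vector `x` the value
`x* A x`, which is a dual number, is positive and appreciable. -/
def IsPosDef {n : ℕ} (A : Matrix (Fin n) (Fin n) DualQuaternion) : Prop :=
  A.IsHermitian ∧ ∀ x : Fin n → DualQuaternion, AppreciableVec x →
    ∃ d : DualReal, star x ⬝ᵥ (A *ᵥ x) = ofDual d ∧ 0 < d ∧ d.Appreciable

end DualQuaternion

/-! Write `A = A₀ + A₁ε` with `A₀`, `A₁` Hermitian over the quaternions. The argument is first-order
degenerate perturbation theory. A unitary `W` diagonalizes `A₀` as `diag a`; inside each eigenspace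
of `A₀` the basis is still free, and it is chosen to diagonalize the compression of `A₁` to that
eigenspace, with entries `b` (`exists_unitary_block_diagonalizing`). The entries of `C = Wᴴ A₁ W`
between distinct eigenvalues are commutators with `diag a`, so a factor `1 + Kε` with `K`
skew-Hermitian removes them. Then `U = W(1 + Kε)` is unitary and diagonalizes `A` with eigenvalues
`a i + b i ε` (`exists_unitary_mul_diagonal`).

The remaining claims are read off in the coordinates `c = Uᴴ x`, using that dual numbers are central
and that a dual quaternion with nonzero standard part is a unit. -/

theorem LinearMap.IsSymmetric.exists_eigenvector_mem {E : Type*} [NormedAddCommGroup E]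
    [InnerProductSpace ℝ E] [FiniteDimensional ℝ E] {T : E →ₗ[ℝ] E} (hT : T.IsSymmetric)
    {W : Submodule ℝ E} (hW : W ≠ ⊥) (hTW : ∀ x ∈ W, T x ∈ W) :
    ∃ μ : ℝ, ∃ x ∈ W, x ≠ 0 ∧ T x = μ • x := by
  have : Nontrivial W := Submodule.nontrivial_iff_ne_bot.2 hW
  obtain ⟨x, hx⟩ :=
    (hT.restrict_invariant hTW).hasEigenvalue_iSup_of_finiteDimensional.exists_hasEigenvector
  exact ⟨_, x, x.2, fun h => hx.2 (Subtype.ext h), congrArg Subtype.val hx.apply_eq_smul⟩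

/-! ### Simultaneous diagonalization of commuting Hermitian quaternion matrices -/

namespace QuaternionMatrix

variable {ι : Type*} [Fintype ι]

theorem smul_eq_mul_coe (r : ℝ) (q : ℍ[ℝ]) : r • q = q * (r : ℍ[ℝ]) := by
  rw [← Quaternion.coe_commutes, Quaternion.coe_mul_eq_smul]

/-- This makes a Hermitian quaternion matrix a symmetric real operator, so the real spectral theorem
supplies eigenvectors with real eigenvalues. -/
theorem inner_eq_re_dotProduct (x y : PiLp 2 fun _ : ι => ℍ[ℝ]) :
    inner ℝ x y = (star x.ofLp ⬝ᵥ y.ofLp).re := by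
  have h : (star x.ofLp ⬝ᵥ y.ofLp).re = ∑ i, (star (x.ofLp i) * y.ofLp i).re :=
    map_sum (QuaternionAlgebra.reₗ (-1 : ℝ) 0 (-1)) _ _
  rw [PiLp.inner_apply, h]
  refine Finset.sum_congr rfl fun i _ => ?_
  simp only [Quaternion.inner_def, Quaternion.re_mul, Quaternion.re_star, Quaternion.imI_star,
    Quaternion.imJ_star, Quaternion.imK_star]
  ring

theorem star_real_smul {κ : Type*} (r : ℝ) (x : κ → ℍ[ℝ]) : star (r • x) = r • star x :=
  funext fun _ => Quaternion.star_smul _ _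

theorem star_dotProduct_mulVec {R : Type*} [NonUnitalSemiring R] [StarRing R]
    {A : Matrix ι ι R} (hA : A.IsHermitian) (x y : ι → R) :
    star x ⬝ᵥ (A *ᵥ y) = star (A *ᵥ x) ⬝ᵥ y := by
  rw [Matrix.star_mulVec, hA.eq, Matrix.dotProduct_mulVec]

/-- The real-linear endomorphism of the Euclidean space `ℍⁿ` given by a quaternion matrix. -/
noncomputable def toRealLin (A : Matrix ι ι ℍ[ℝ]) :
    (PiLp 2 fun _ : ι => ℍ[ℝ]) →ₗ[ℝ] (PiLp 2 fun _ : ι => ℍ[ℝ]) where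
  toFun x := WithLp.toLp 2 (A *ᵥ x.ofLp)
  map_add' x y := by simp [Matrix.mulVec_add]
  map_smul' r x := by simp [Matrix.mulVec_smul]

theorem isSymmetric_toRealLin {A : Matrix ι ι ℍ[ℝ]} (hA : A.IsHermitian) :
    (toRealLin A).IsSymmetric := by
  intro x y
  rw [inner_eq_re_dotProduct, inner_eq_re_dotProduct]
  exact congrArg _ (star_dotProduct_mulVec hA _ _).symm

theorem star_dotProduct_self (x : ι → ℍ[ℝ]) :
    star x ⬝ᵥ x = ((∑ i, Quaternion.normSq (x i) : ℝ) : ℍ[ℝ]) := by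
  have h : ((∑ i, Quaternion.normSq (x i) : ℝ) : ℍ[ℝ])
      = ∑ i, ((Quaternion.normSq (x i) : ℝ) : ℍ[ℝ]) :=
    map_sum (algebraMap ℝ ℍ[ℝ]) _ _
  rw [h, dotProduct]
  exact Finset.sum_congr rfl fun i _ => Quaternion.star_mul_self _

theorem exists_smul_unit {x : ι → ℍ[ℝ]} (hx : x ≠ 0) :
    ∃ r : ℝ, star (r • x) ⬝ᵥ (r • x) = 1 := by
  set s := ∑ i, Quaternion.normSq (x i) with hs
  have hpos : 0 < s := by
    obtain ⟨i, hi⟩ := Function.ne_iff.1 hx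
    exact Finset.sum_pos' (fun _ _ => Quaternion.normSq_nonneg)
      ⟨i, Finset.mem_univ i, lt_of_le_of_ne Quaternion.normSq_nonneg
        (Quaternion.normSq_ne_zero.2 hi).symm⟩
  refine ⟨(√s)⁻¹, ?_⟩
  rw [star_real_smul, smul_dotProduct, dotProduct_smul, star_dotProduct_self, ← hs, smul_smul,
    ← mul_inv, Real.mul_self_sqrt hpos.le, ← Quaternion.coe_smul, smul_eq_mul,
    inv_mul_cancel₀ hpos.ne', Quaternion.coe_one]

/-- Two commuting Hermitian quaternion matrices have a common unit eigenvector orthogonal to any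
given family of fewer than `n` common eigenvectors. -/
theorem exists_common_eigenvector {A B : Matrix ι ι ℍ[ℝ]} (hA : A.IsHermitian)
    (hB : B.IsHermitian) (hAB : A * B = B * A) {k : ℕ} (hk : k < Fintype.card ι)
    {u : Fin k → ι → ℍ[ℝ]} {a b : Fin k → ℝ} (ha : ∀ j, A *ᵥ u j = a j • u j)
    (hb : ∀ j, B *ᵥ u j = b j • u j) :
    ∃ (x : ι → ℍ[ℝ]) (r s : ℝ), (∀ j, star (u j) ⬝ᵥ x = 0) ∧ star x ⬝ᵥ x = 1 ∧
      A *ᵥ x = r • x ∧ B *ᵥ x = s • x := by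
  let f : (PiLp 2 fun _ : ι => ℍ[ℝ]) →ₗ[ℝ] (Fin k → ℍ[ℝ]) :=
    { toFun := fun x j => star (u j) ⬝ᵥ x.ofLp
      map_add' := fun x y => by ext1 j; simp [dotProduct_add]
      map_smul' := fun r x => by ext1 j; simp [dotProduct_smul] }
  have hf (x) : x ∈ LinearMap.ker f ↔ ∀ j, star (u j) ⬝ᵥ x.ofLp = 0 := by
    rw [LinearMap.mem_ker]; exact funext_iff
  -- The real dimensions of source and target are `4 * card ι` and `4 * k`.
  have hker : LinearMap.ker f ≠ ⊥ := by
    apply LinearMap.ker_ne_bot_of_finrank_lt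
    rw [LinearEquiv.finrank_eq (WithLp.linearEquiv 2 ℝ (ι → ℍ[ℝ])), Module.finrank_pi_fintype,
      Module.finrank_pi_fintype]
    simpa [Quaternion.finrank_eq_four] using hk
  have hinv {M : Matrix ι ι ℍ[ℝ]} (hM : M.IsHermitian) {c : Fin k → ℝ}
      (hc : ∀ j, M *ᵥ u j = c j • u j) (x) (hx : x ∈ LinearMap.ker f) :
      toRealLin M x ∈ LinearMap.ker f := by
    rw [hf] at hx ⊢
    intro j
    change star (u j) ⬝ᵥ (M *ᵥ x.ofLp) = 0
    rw [star_dotProduct_mulVec hM, hc, star_real_smul, smul_dotProduct, hx, smul_zero]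
  obtain ⟨r, y, hy, hy0, hyr⟩ :=
    (isSymmetric_toRealLin hA).exists_eigenvector_mem hker (hinv hA ha)
  -- The `r`-eigenspace of `A` inside the orthogonal complement of the `u j` is preserved by `B`,
  -- because `A` and `B` commute.
  let W := LinearMap.ker f ⊓ LinearMap.ker (toRealLin A - r • LinearMap.id)
  have hW (x) : x ∈ W ↔ x ∈ LinearMap.ker f ∧ toRealLin A x = r • x := by
    simp [W, sub_eq_zero]
  have hWb : W ≠ ⊥ := fun h => hy0 <| (Submodule.mem_bot ℝ).1 (h ▸ (hW y).2 ⟨hy, hyr⟩)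
  obtain ⟨s, x, hx, hx0, hxs⟩ := (isSymmetric_toRealLin hB).exists_eigenvector_mem hWb
    (fun x hx => by
      rw [hW] at hx ⊢
      refine ⟨hinv hB hb x hx.1, ?_⟩
      have h1 : toRealLin A (toRealLin B x) = toRealLin B (toRealLin A x) := by
        simp [toRealLin, Matrix.mulVec_mulVec, hAB]
      rw [h1, hx.2, map_smul])
  rw [hW, hf] at hx
  have hAx : A *ᵥ x.ofLp = r • x.ofLp := congrArg WithLp.ofLp hx.2
  have hBx : B *ᵥ x.ofLp = s • x.ofLp := congrArg WithLp.ofLp hxs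
  obtain ⟨t, ht⟩ := exists_smul_unit (x := x.ofLp) (fun h => hx0 (WithLp.ofLp_injective 2 h))
  refine ⟨t • x.ofLp, r, s, fun j => ?_, ht, ?_, ?_⟩
  · rw [dotProduct_smul, hx.1, smul_zero]
  · rw [Matrix.mulVec_smul, hAx, smul_comm]
  · rw [Matrix.mulVec_smul, hBx, smul_comm]

theorem exists_orthonormal_eigenvectors {A B : Matrix ι ι ℍ[ℝ]} (hA : A.IsHermitian)
    (hB : B.IsHermitian) (hAB : A * B = B * A) (k : ℕ) (hk : k ≤ Fintype.card ι) :
    ∃ (u : Fin k → ι → ℍ[ℝ]) (a b : Fin k → ℝ),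
      (∀ i j, star (u i) ⬝ᵥ u j = if i = j then 1 else 0) ∧
      (∀ j, A *ᵥ u j = a j • u j) ∧ ∀ j, B *ᵥ u j = b j • u j := by
  induction k with
  | zero => exact ⟨Fin.elim0, Fin.elim0, Fin.elim0, fun i => i.elim0, fun i => i.elim0,
      fun i => i.elim0⟩
  | succ k ih =>
    obtain ⟨u, a, b, hu, ha, hb⟩ := ih (by omega)
    obtain ⟨x, r, s, hx, hx1, hr, hs⟩ := exists_common_eigenvector hA hB hAB hk ha hb
    have hx' (j) : star x ⬝ᵥ u j = 0 := by
      rw [Matrix.star_dotProduct, hx, star_zero]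
    refine ⟨Fin.snoc u x, Fin.snoc a r, Fin.snoc b s, fun i j => ?_, fun j => ?_, fun j => ?_⟩
    · refine Fin.lastCases ?_ (fun i => ?_) i <;> refine Fin.lastCases ?_ (fun j => ?_) j
      · simpa using hx1
      · simpa [(Fin.castSucc_lt_last j).ne'] using hx' j
      · simpa [(Fin.castSucc_lt_last i).ne] using hx i
      · simpa using hu i j
    · refine Fin.lastCases ?_ (fun j => ?_) j
      · simpa using hr
      · simpa using ha j
    · refine Fin.lastCases ?_ (fun j => ?_) j
      · simpa using hs
      · simpa using hb j

/-- Commuting Hermitian quaternion matrices are simultaneously diagonalized, with real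
eigenvalues, by a unitary quaternion matrix. -/
theorem exists_unitary_diagonalizing [DecidableEq ι] {A B : Matrix ι ι ℍ[ℝ]}
    (hA : A.IsHermitian) (hB : B.IsHermitian) (hAB : A * B = B * A) :
    ∃ (U : Matrix ι ι ℍ[ℝ]) (a b : ι → ℝ), Uᴴ * U = 1 ∧
      A * U = U * Matrix.diagonal (fun i => (a i : ℍ[ℝ])) ∧
      B * U = U * Matrix.diagonal (fun i => (b i : ℍ[ℝ])) := by
  obtain ⟨u, a, b, hu, ha, hb⟩ := exists_orthonormal_eigenvectors hA hB hAB _ le_rfl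
  let e := Fintype.equivFin ι
  refine ⟨Matrix.of fun i j => u (e j) i, a ∘ e, b ∘ e, ?_, ?_, ?_⟩
  · ext1 i j
    exact (hu (e i) (e j)).trans (by simp only [Matrix.one_apply, e.injective.eq_iff])
  · ext1 i j
    rw [Matrix.mul_diagonal, Function.comp, ← smul_eq_mul_coe]
    exact congrFun (ha (e j)) i
  · ext1 i j
    rw [Matrix.mul_diagonal, Function.comp, ← smul_eq_mul_coe]
    exact congrFun (hb (e j)) i

end QuaternionMatrix

/-! ### Standard and infinitesimal parts of dual quaternion matrices -/

namespace DualQuaternion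

@[simp] theorem fst_ofDual (p : DualReal) : (ofDual p).fst = (p.fst : ℍ[ℝ]) := by simp [ofDual]

@[simp] theorem snd_ofDual (p : DualReal) : (ofDual p).snd = (p.snd : ℍ[ℝ]) := by simp [ofDual]

@[simp] theorem fst_star (q : DualQuaternion) : (star q).fst = star q.fst := by
  simp [star]

@[simp] theorem snd_star (q : DualQuaternion) : (star q).snd = star q.snd := by
  simp [star]

theorem snd_mul_eq (p q : DualQuaternion) : (p * q).snd = p.fst * q.snd + p.snd * q.fst := by
  simp

theorem ofDual_injective : Function.Injective ofDual := fun p q h => by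
  apply TrivSqZeroExt.ext
  · simpa using congrArg TrivSqZeroExt.fst h
  · simpa using congrArg TrivSqZeroExt.snd h

variable {ι : Type*}

/-- The dual quaternion matrix with standard part `W` and infinitesimal part `X`. -/
noncomputable def mkMatrix (W X : Matrix ι ι ℍ[ℝ]) : Matrix ι ι DualQuaternion :=
  Matrix.of fun i j => TrivSqZeroExt.inl (W i j) + TrivSqZeroExt.inr (X i j)

@[simp] theorem map_fst_mkMatrix (W X : Matrix ι ι ℍ[ℝ]) :
    (mkMatrix W X).map TrivSqZeroExt.fst = W := by
  ext1 i j; simp [mkMatrix]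

@[simp] theorem map_snd_mkMatrix (W X : Matrix ι ι ℍ[ℝ]) :
    (mkMatrix W X).map TrivSqZeroExt.snd = X := by
  ext1 i j; simp [mkMatrix]

theorem matrix_ext {M N : Matrix ι ι DualQuaternion}
    (h₁ : M.map TrivSqZeroExt.fst = N.map TrivSqZeroExt.fst)
    (h₂ : M.map TrivSqZeroExt.snd = N.map TrivSqZeroExt.snd) : M = N := by
  ext1 i j
  exact TrivSqZeroExt.ext (congrFun (congrFun h₁ i) j) (congrFun (congrFun h₂ i) j)

theorem map_fst_mul [Fintype ι] (M N : Matrix ι ι DualQuaternion) :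
    (M * N).map TrivSqZeroExt.fst = M.map TrivSqZeroExt.fst * N.map TrivSqZeroExt.fst := by
  ext1 i j
  simp [Matrix.mul_apply, TrivSqZeroExt.fst_sum]

theorem map_snd_mul [Fintype ι] (M N : Matrix ι ι DualQuaternion) :
    (M * N).map TrivSqZeroExt.snd = M.map TrivSqZeroExt.fst * N.map TrivSqZeroExt.snd +
      M.map TrivSqZeroExt.snd * N.map TrivSqZeroExt.fst := by
  ext1 i j
  simp only [Matrix.map_apply, Matrix.mul_apply, TrivSqZeroExt.snd_sum, Matrix.add_apply,
    ← Finset.sum_add_distrib, snd_mul_eq]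

theorem map_fst_conjTranspose (M : Matrix ι ι DualQuaternion) :
    Mᴴ.map TrivSqZeroExt.fst = (M.map TrivSqZeroExt.fst)ᴴ := by
  ext1 i j; simp

theorem map_snd_conjTranspose (M : Matrix ι ι DualQuaternion) :
    Mᴴ.map TrivSqZeroExt.snd = (M.map TrivSqZeroExt.snd)ᴴ := by
  ext1 i j; simp

section DecidableEq

variable [DecidableEq ι]

theorem map_fst_one : (1 : Matrix ι ι DualQuaternion).map TrivSqZeroExt.fst = 1 :=
  Matrix.map_one _ rfl rfl

theorem map_snd_one : (1 : Matrix ι ι DualQuaternion).map TrivSqZeroExt.snd = 0 := by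
  ext1 i j
  rcases eq_or_ne i j with rfl | h
  · simp
  · simp [h]

theorem map_fst_diagonal (d : ι → DualQuaternion) :
    (Matrix.diagonal d).map TrivSqZeroExt.fst = Matrix.diagonal fun i => (d i).fst :=
  Matrix.diagonal_map rfl

theorem map_snd_diagonal (d : ι → DualQuaternion) :
    (Matrix.diagonal d).map TrivSqZeroExt.snd = Matrix.diagonal fun i => (d i).snd :=
  Matrix.diagonal_map rfl

/-! ### Unitary diagonalization of Hermitian dual quaternion matrices -/

variable [Fintype ι]

/-- The real diagonal matrix `diag a` and the pinching of `B` by the equalities among the `a i` are simultaneously diagonalized; conjugation of `B` by the resulting unitary matrix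
agrees with that of its pinching on these blocks. -/
theorem exists_unitary_diagonalizing_pinching {a : ι → ℝ} {B : Matrix ι ι ℍ[ℝ]}
    (hB : B.IsHermitian) :
    ∃ (V : Matrix ι ι ℍ[ℝ]) (a' b : ι → ℝ), Vᴴ * V = 1 ∧
      Matrix.diagonal (fun i => (a i : ℍ[ℝ])) * V
        = V * Matrix.diagonal (fun i => (a' i : ℍ[ℝ])) ∧
      ∀ i j, a' i = a' j → (Vᴴ * B * V) i j = if i = j then (b i : ℍ[ℝ]) else 0 := by
  let P : Matrix ι ι ℍ[ℝ] := Matrix.of fun i j => if a i = a j then B i j else 0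
  have hP : P.IsHermitian := by
    ext1 i j
    simp only [P, Matrix.conjTranspose_apply, Matrix.of_apply, eq_comm (a := a j)]
    split_ifs
    · exact hB.apply i j
    · exact star_zero _
  have hD : (Matrix.diagonal (fun i => (a i : ℍ[ℝ]))).IsHermitian :=
    Matrix.isHermitian_diagonal_iff.2 fun i => Quaternion.star_coe _
  obtain ⟨V, a', b, hV, ha, hb⟩ := QuaternionMatrix.exists_unitary_diagonalizing hD hP (by
    ext1 i j
    rw [Matrix.diagonal_mul, Matrix.mul_diagonal]
    simp only [P, Matrix.of_apply]
    split_ifs with h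
    · rw [h, Quaternion.coe_commutes]
    · simp)
  -- Each column of `V` is supported on a single block of equal `a i`, so block entries of `Vᴴ * B *
  -- V` see only the entries of `B` kept in `P`.
  have hV0 (i j) (h : a i ≠ a' j) : V i j = 0 := by
    have h1 := congrFun (congrFun ha i) j
    rw [Matrix.diagonal_mul, Matrix.mul_diagonal, ← Quaternion.coe_commutes, ← sub_eq_zero,
      ← sub_mul, ← Quaternion.coe_sub, mul_eq_zero] at h1
    refine h1.resolve_left fun h2 => h (sub_eq_zero.1 ?_)
    exact Quaternion.coe_injective h2
  refine ⟨V, a', b, hV, ha, fun i j hij => ?_⟩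
  have h1 : Vᴴ * P * V = Matrix.diagonal (fun i => (b i : ℍ[ℝ])) := by
    rw [Matrix.mul_assoc, hb, ← Matrix.mul_assoc, hV, Matrix.one_mul]
  rw [← Matrix.diagonal_apply (fun i => (b i : ℍ[ℝ])), ← h1]
  simp only [Matrix.mul_apply, Finset.sum_mul]
  refine Finset.sum_congr rfl fun l _ => Finset.sum_congr rfl fun k _ => ?_
  by_cases hk : a k = a' i
  · by_cases hl : a l = a' j
    · simp [P, hk, hl, hij]
    · simp [hV0 l j hl]
  · simp [hV0 k i hk]

/-- `U` diagonalizes `A`; the further factor `V` only mixes eigenvectors of equal eigenvalue, and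
this freedom is spent on `B`. No commutation of `A` and `B` is needed, since nothing is claimed
between different eigenvalues. -/
theorem exists_unitary_block_diagonalizing {A B : Matrix ι ι ℍ[ℝ]} (hA : A.IsHermitian)
    (hB : B.IsHermitian) :
    ∃ (W : Matrix ι ι ℍ[ℝ]) (a b : ι → ℝ), Wᴴ * W = 1 ∧
      A * W = W * Matrix.diagonal (fun i => (a i : ℍ[ℝ])) ∧
      ∀ i j, a i = a j → (Wᴴ * B * W) i j = if i = j then (b i : ℍ[ℝ]) else 0 := by
  obtain ⟨U, a, _, hU, ha, -⟩ := QuaternionMatrix.exists_unitary_diagonalizing hA hA rfl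
  obtain ⟨V, a', b, hV, ha', hb⟩ := exists_unitary_diagonalizing_pinching (a := a)
    (Matrix.isHermitian_conjTranspose_mul_mul U hB)
  refine ⟨U * V, a', b, ?_, ?_, fun i j h => ?_⟩
  · rw [Matrix.conjTranspose_mul, Matrix.mul_assoc, ← Matrix.mul_assoc Uᴴ, hU, Matrix.one_mul, hV]
  · rw [← Matrix.mul_assoc, ha, Matrix.mul_assoc, ha', Matrix.mul_assoc]
  · rw [← hb i j h, Matrix.conjTranspose_mul]
    simp only [Matrix.mul_assoc]

/-- A Hermitian dual quaternion matrix is unitarily diagonalizable with dual number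
eigenvalues. -/
theorem exists_unitary_mul_diagonal {A : Matrix ι ι DualQuaternion} (hA : A.IsHermitian) :
    ∃ (U : Matrix ι ι DualQuaternion) (σ : ι → DualReal), Uᴴ * U = 1 ∧ U * Uᴴ = 1 ∧
      A * U = U * Matrix.diagonal (fun i => ofDual (σ i)) := by
  have h₁ : (A.map TrivSqZeroExt.fst).IsHermitian := by
    rw [Matrix.IsHermitian, ← map_fst_conjTranspose, hA.eq]
  have h₂ : (A.map TrivSqZeroExt.snd).IsHermitian := by
    rw [Matrix.IsHermitian, ← map_snd_conjTranspose, hA.eq]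
  obtain ⟨W, a, b, hW, ha, hb⟩ := exists_unitary_block_diagonalizing h₁ h₂
  have hW' : W * Wᴴ = 1 := mul_eq_one_comm.1 hW
  set C := Wᴴ * A.map TrivSqZeroExt.snd * W with hC
  have hCh : C.IsHermitian := Matrix.isHermitian_conjTranspose_mul_mul W h₂
  -- Off the blocks, `K` solves `C i j = (a j - a i) • K i j`. On the blocks `0⁻¹ = 0` gives `K i j
  -- = 0`, which keeps `K` skew-Hermitian.
  let K : Matrix ι ι ℍ[ℝ] := Matrix.of fun i j => (a j - a i)⁻¹ • C i j
  have hK : Kᴴ = -K := by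
    ext1 i j
    simp only [K, Matrix.conjTranspose_apply, Matrix.of_apply, Matrix.neg_apply]
    rw [Quaternion.star_smul, hCh.apply, ← neg_sub (a j), inv_neg, neg_smul]
  have hCK : C + Matrix.diagonal (fun i => (a i : ℍ[ℝ])) * K =
      Matrix.diagonal (fun i => (b i : ℍ[ℝ])) + K * Matrix.diagonal (fun i => (a i : ℍ[ℝ])) := by
    ext1 i j
    rw [Matrix.add_apply, Matrix.add_apply, Matrix.diagonal_mul, Matrix.mul_diagonal,
      ← Quaternion.coe_commutes, Quaternion.coe_mul_eq_smul, Quaternion.coe_mul_eq_smul,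
      Matrix.diagonal_apply]
    by_cases h : a i = a j
    · rw [hb i j h, h]
    · have hij : i ≠ j := fun h' => h (h' ▸ rfl)
      have h0 : a j - a i ≠ 0 := sub_ne_zero.2 (Ne.symm h)
      have hCij : C i j = (a j - a i) • K i j := (smul_inv_smul₀ h0 _).symm
      rw [if_neg hij, zero_add, hCij, sub_smul, sub_add_cancel]
  have hAW : A.map TrivSqZeroExt.snd * W = W * C := by
    rw [hC, ← Matrix.mul_assoc, ← Matrix.mul_assoc, hW', Matrix.one_mul]
  refine ⟨mkMatrix W (W * K), fun i => TrivSqZeroExt.inl (a i) + TrivSqZeroExt.inr (b i),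
    matrix_ext ?_ ?_, matrix_ext ?_ ?_, matrix_ext ?_ ?_⟩
  · rw [map_fst_mul, map_fst_conjTranspose, map_fst_mkMatrix, map_fst_one, hW]
  · rw [map_snd_mul, map_fst_conjTranspose, map_snd_conjTranspose, map_fst_mkMatrix,
      map_snd_mkMatrix, map_snd_one, Matrix.conjTranspose_mul, Matrix.mul_assoc, hW,
      ← Matrix.mul_assoc, hW, Matrix.mul_one, Matrix.one_mul, hK, add_neg_cancel]
  · rw [map_fst_mul, map_fst_conjTranspose, map_fst_mkMatrix, map_fst_one, hW']
  · rw [map_snd_mul, map_fst_conjTranspose, map_snd_conjTranspose, map_fst_mkMatrix,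
      map_snd_mkMatrix, map_snd_one, Matrix.conjTranspose_mul, hK, ← Matrix.mul_assoc,
      Matrix.mul_neg, Matrix.neg_mul, neg_add_cancel]
  · rw [map_fst_mul, map_fst_mul, map_fst_diagonal, map_fst_mkMatrix, ha]
    simp
  -- After factoring out `W` on the left, the infinitesimal part of `A * U = U * diag σ` is exactly
  -- `hCK`.
  · rw [map_snd_mul, map_snd_mul, map_fst_diagonal, map_snd_diagonal, map_fst_mkMatrix,
      map_snd_mkMatrix, ← Matrix.mul_assoc, ha, hAW, Matrix.mul_assoc, Matrix.mul_assoc,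
      ← Matrix.mul_add, ← Matrix.mul_add, add_comm, hCK]
    simp

end DecidableEq

theorem exists_antitone_unitary_mul_diagonal {n : ℕ} {A : Matrix (Fin n) (Fin n) DualQuaternion}
    (hA : A.IsHermitian) :
    ∃ (U : Matrix (Fin n) (Fin n) DualQuaternion) (σ : Fin n → DualReal), Antitone σ ∧
      Uᴴ * U = 1 ∧ U * Uᴴ = 1 ∧ A * U = U * Matrix.diagonal (fun i => ofDual (σ i)) := by
  obtain ⟨U, σ, h₁, h₂, h₃⟩ := exists_unitary_mul_diagonal hA
  -- `Tuple.sort` sorts increasingly, hence the reversal.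
  let e : Equiv.Perm (Fin n) := Fin.revPerm.trans (Tuple.sort σ)
  refine ⟨U.submatrix id e, σ ∘ e, ?_, ?_, ?_, ?_⟩
  · exact (Tuple.monotone_sort σ).comp_antitone Fin.rev_anti
  · rw [Matrix.conjTranspose_submatrix, ← Matrix.submatrix_mul _ _ _ _ _ Function.bijective_id,
      h₁, Matrix.submatrix_one_equiv]
  · rw [Matrix.conjTranspose_submatrix, Matrix.submatrix_mul_equiv, h₂, Matrix.submatrix_id_id]
  · ext1 i j
    have h := congrFun (congrFun h₃ i) (e j)
    rw [Matrix.mul_diagonal] at h ⊢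
    exact h

end DualQuaternion

/-! ### Positivity in the lexicographic order -/

namespace DualReal

theorem zero_le_iff {p : DualReal} : 0 ≤ p ↔ 0 < p.fst ∨ (0 = p.fst ∧ 0 ≤ p.snd) := Iff.rfl

theorem add_nonneg {p q : DualReal} (hp : 0 ≤ p) (hq : 0 ≤ q) : 0 ≤ p + q := by
  rw [zero_le_iff] at *
  rw [TrivSqZeroExt.fst_add, TrivSqZeroExt.snd_add]
  rcases hp with hp | ⟨hp, hp'⟩ <;> rcases hq with hq | ⟨hq, hq'⟩
  · exact Or.inl (by linarith)
  · exact Or.inl (by linarith)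
  · exact Or.inl (by linarith)
  · exact Or.inr ⟨by linarith, by linarith⟩

/-- If one standard part vanishes, the infinitesimal part of the product is a nonnegative standard
part times a nonnegative infinitesimal part; if both vanish, the product is zero. -/
theorem mul_nonneg {p q : DualReal} (hp : 0 ≤ p) (hq : 0 ≤ q) : 0 ≤ p * q := by
  rw [zero_le_iff] at *
  simp only [TrivSqZeroExt.fst_mul, TrivSqZeroExt.snd_mul, smul_eq_mul, MulOpposite.smul_eq_mul_unop,
    MulOpposite.unop_op]
  rcases hp with hp | ⟨hp, hp'⟩ <;> rcases hq with hq | ⟨hq, hq'⟩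
  · exact Or.inl (by positivity)
  · exact Or.inr ⟨by simp [← hq], by rw [← hq, mul_zero, add_zero]; positivity⟩
  · exact Or.inr ⟨by simp [← hp], by rw [← hp, zero_mul, zero_add]; positivity⟩
  · exact Or.inr ⟨by simp [← hp], by simp [← hp, ← hq]⟩

theorem sum_nonneg {ι : Type*} (s : Finset ι) {f : ι → DualReal} (hf : ∀ i, 0 ≤ f i) :
    0 ≤ ∑ i ∈ s, f i :=
  Finset.sum_induction f (0 ≤ ·) (fun _ _ => add_nonneg) le_rfl fun i _ => hf i

theorem pos_and_appreciable_iff {p : DualReal} : (0 < p ∧ p.Appreciable) ↔ 0 < p.fst := by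
  constructor
  · rintro ⟨h, h'⟩
    rcases zero_le_iff.1 h.le with h | ⟨h, -⟩
    · exact h
    · exact absurd h.symm h'
  · intro h
    refine ⟨lt_of_le_of_ne (Or.inl h) ?_, h.ne'⟩
    rintro rfl
    exact lt_irrefl _ h

end DualReal

/-! ### Central dual numbers, squared magnitudes and appreciable vectors -/

namespace DualQuaternion

theorem ofDual_mul_comm (p : DualReal) (q : DualQuaternion) : ofDual p * q = q * ofDual p := by
  apply TrivSqZeroExt.ext
  · simp [Quaternion.coe_commutes]
  · simp [Quaternion.coe_commutes, add_comm]

theorem ofDual_mul (p q : DualReal) : ofDual (p * q) = ofDual p * ofDual q := by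
  apply TrivSqZeroExt.ext
  · simp
  · simp

/-- `ofDual` as a homomorphism of additive groups. -/
noncomputable def ofDualAddHom : DualReal →+ DualQuaternion where
  toFun := ofDual
  map_zero' := by apply TrivSqZeroExt.ext <;> simp
  map_add' p q := by apply TrivSqZeroExt.ext <;> simp

theorem ofDual_sum {ι : Type*} (s : Finset ι) (f : ι → DualReal) :
    ofDual (∑ i ∈ s, f i) = ∑ i ∈ s, ofDual (f i) :=
  map_sum ofDualAddHom f s

/-- The squared magnitude `q* q` as a dual number. -/
noncomputable def normSq (q : DualQuaternion) : DualReal :=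
  TrivSqZeroExt.inl (Quaternion.normSq q.fst) + TrivSqZeroExt.inr (2 * (star q.fst * q.snd).re)

@[simp] theorem fst_normSq (q : DualQuaternion) : (normSq q).fst = Quaternion.normSq q.fst := by
  simp [normSq]

theorem star_mul_self_eq (q : DualQuaternion) : star q * q = ofDual (normSq q) := by
  apply TrivSqZeroExt.ext
  · rw [TrivSqZeroExt.fst_mul, fst_star, fst_ofDual, fst_normSq, Quaternion.star_mul_self]
  · rw [snd_mul_eq, fst_star, snd_star, snd_ofDual]
    have h := Quaternion.self_add_star (star q.fst * q.snd)
    rw [star_mul, star_star] at h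
    rw [h, normSq, TrivSqZeroExt.snd_add, TrivSqZeroExt.snd_inl, TrivSqZeroExt.snd_inr, zero_add,
      Quaternion.coe_mul]
    rfl

/-- The infinitesimal part has no sign in general, but it vanishes together with the standard part
of `q`. -/
theorem normSq_nonneg (q : DualQuaternion) : 0 ≤ normSq q := by
  rw [DualReal.zero_le_iff]
  rcases (Quaternion.normSq_nonneg (a := q.fst)).lt_or_eq with h | h
  · exact Or.inl (by rwa [fst_normSq])
  · refine Or.inr ⟨by rwa [fst_normSq], ?_⟩
    have h0 : q.fst = 0 := Quaternion.normSq_eq_zero.1 h.symm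
    simp [normSq, h0]

theorem isUnit_of_fst_ne_zero {q : DualQuaternion} (hq : q.fst ≠ 0) : IsUnit q :=
  TrivSqZeroExt.isUnit_iff_isUnit_fst.2 (isUnit_iff_ne_zero.2 hq)

variable {n : ℕ}

theorem fst_mulVec {m : ℕ} (M : Matrix (Fin m) (Fin n) DualQuaternion) (x : Fin n → DualQuaternion)
    (i : Fin m) : ((M *ᵥ x) i).fst = ∑ j, (M i j).fst * (x j).fst := by
  simp [Matrix.mulVec, dotProduct, TrivSqZeroExt.fst_sum]

/-- Applied with `M = U` to the vector `Uᴴ *ᵥ x`, this shows that passing to eigenbasis coordinates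
preserves appreciability. -/
theorem AppreciableVec.of_mulVec {M : Matrix (Fin n) (Fin n) DualQuaternion}
    {x : Fin n → DualQuaternion} (h : AppreciableVec (M *ᵥ x)) : AppreciableVec x := by
  obtain ⟨i, hi⟩ := h
  rw [fst_mulVec] at hi
  obtain ⟨j, -, hj⟩ := Finset.exists_ne_zero_of_sum_ne_zero hi
  exact ⟨j, right_ne_zero_of_mul hj⟩

theorem isRightEigenvector_diagonal_iff {d : Fin n → DualReal} {l : DualQuaternion}
    {c : Fin n → DualQuaternion} :
    IsRightEigenvector (Matrix.diagonal fun i => ofDual (d i)) l c ↔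
      AppreciableVec c ∧ ∀ i, ofDual (d i) * c i = c i * l := by
  simp only [IsRightEigenvector, funext_iff, Matrix.mulVec_diagonal]

theorem mulVec_mul_right (M : Matrix (Fin n) (Fin n) DualQuaternion) (x : Fin n → DualQuaternion)
    (l : DualQuaternion) : (M *ᵥ fun i => x i * l) = fun i => (M *ᵥ x) i * l := by
  ext1 i
  simp only [Matrix.mulVec, dotProduct, Finset.sum_mul, mul_assoc]

/-! ### Right eigenvalues, multiplicities and definiteness from a diagonalization -/

section Diagonalized

variable {A U : Matrix (Fin n) (Fin n) DualQuaternion} {σ : Fin n → DualReal}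

theorem IsRightEigenvector.conjTranspose_mulVec (hU' : U * Uᴴ = 1)
    (hU : Uᴴ * U = 1) (hA : A * U = U * Matrix.diagonal fun i => ofDual (σ i))
    {l : DualQuaternion} {x : Fin n → DualQuaternion} (hx : IsRightEigenvector A l x) :
    IsRightEigenvector (Matrix.diagonal fun i => ofDual (σ i)) l (Uᴴ *ᵥ x) := by
  refine ⟨.of_mulVec (M := U) ?_, ?_⟩
  · rw [Matrix.mulVec_mulVec, hU', Matrix.one_mulVec]
    exact hx.1
  · have h : (Matrix.diagonal fun i => ofDual (σ i)) * Uᴴ = Uᴴ * A := by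
      rw [← Matrix.one_mul (Matrix.diagonal _), ← hU, Matrix.mul_assoc Uᴴ, ← hA, Matrix.mul_assoc,
        Matrix.mul_assoc, hU', Matrix.mul_one]
    rw [Matrix.mulVec_mulVec, h, ← Matrix.mulVec_mulVec, hx.2, mulVec_mul_right]

theorem isEigenvector_col (hU : Uᴴ * U = 1)
    (hA : A * U = U * Matrix.diagonal fun i => ofDual (σ i)) (i : Fin n) :
    IsEigenvector A (σ i) (U.col i) := by
  refine ⟨?_, ?_⟩
  · by_contra h
    simp only [AppreciableVec, not_exists, not_not] at h
    have h1 := congrArg TrivSqZeroExt.fst (congrFun (congrFun hU i) i)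
    have h2 : ∀ j, (U j i).fst = 0 := h
    simp [Matrix.mul_apply, TrivSqZeroExt.fst_sum, h2] at h1
  · ext1 j
    have h := congrFun (congrFun hA j) i
    rw [Matrix.mul_diagonal] at h
    exact h

theorem star_col_dotProduct_col (hU : Uᴴ * U = 1) (i j : Fin n) :
    star (U.col i) ⬝ᵥ U.col j = if i = j then 1 else 0 := by
  rw [← Matrix.one_apply, ← hU]
  rfl

/-- In eigenbasis coordinates `σ i * c i = c i * l` for all `i`. Some `c i` is a unit, and `σ i` is
central, so cancelling `c i` leaves `l = σ i`. -/
theorem isRightEigenvalue_iff (hU' : U * Uᴴ = 1)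
    (hU : Uᴴ * U = 1) (hA : A * U = U * Matrix.diagonal fun i => ofDual (σ i))
    (l : DualQuaternion) : IsRightEigenvalue A l ↔ ∃ i, l = ofDual (σ i) := by
  constructor
  · rintro ⟨x, hx⟩
    obtain ⟨⟨i, hi⟩, h⟩ := isRightEigenvector_diagonal_iff.1 (hx.conjTranspose_mulVec hU' hU hA)
    refine ⟨i, ((isUnit_of_fst_ne_zero hi).mul_left_cancel ?_).symm⟩
    rw [← ofDual_mul_comm, h]
  · rintro ⟨i, rfl⟩
    exact ⟨_, isEigenvector_col hU hA i⟩

theorem linearIndependent_col (hU : Uᴴ * U = 1) :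
    LinearIndependent DualQuaternionᵐᵒᵖ fun i => U.col i := by
  rw [Fintype.linearIndependent_iff]
  intro g hg i
  have h : U *ᵥ (fun j => (g j).unop) = 0 := by
    rw [← hg]
    ext1 k
    simp [Matrix.mulVec, dotProduct]
  have h' : (fun j => (g j).unop) = 0 := by
    rw [← Matrix.one_mulVec (fun j => (g j).unop), ← hU, ← Matrix.mulVec_mulVec, h,
      Matrix.mulVec_zero]
  exact MulOpposite.unop_injective (congrFun h' i)

/-- Coordinates of an eigenvector along eigenvectors of other eigenvalues are infinitesimal. -/
theorem fst_eq_zero_of_ne {s d : DualReal} {c : DualQuaternion} (hsd : s ≠ d)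
    (h : ofDual s * c = c * ofDual d) : c.fst = 0 := by
  by_contra hc
  refine hsd (ofDual_injective ((isUnit_of_fst_ne_zero hc).mul_left_cancel ?_))
  rw [← ofDual_mul_comm, h]

/-- The standard parts of the coordinates at indices with `σ i = d` remain independent over the
quaternions, so their number is bounded by dimension. Indeed a relation `g` among them, multiplied
by `ε`, is a relation among the `v j`: `ε` kills all infinitesimal parts, and the coordinates at the
other indices are infinitesimal. -/
theorem card_le_of_linearIndependent (hU' : U * Uᴴ = 1)
    (hU : Uᴴ * U = 1) (hA : A * U = U * Matrix.diagonal fun i => ofDual (σ i)) {d : DualReal}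
    {k : ℕ} {v : Fin k → Fin n → DualQuaternion} (hv : LinearIndependent DualQuaternionᵐᵒᵖ v)
    (hvd : ∀ j, IsEigenvector A d (v j)) : k ≤ Nat.card {i : Fin n // σ i = d} := by
  have hc (j) := isRightEigenvector_diagonal_iff.1 ((hvd j).conjTranspose_mulVec hU' hU hA)
  let w : Fin k → {i : Fin n // σ i = d} → ℍ[ℝ]ᵐᵒᵖ :=
    fun j i => MulOpposite.op ((Uᴴ *ᵥ v j) i).fst
  have hw : LinearIndependent ℍ[ℝ]ᵐᵒᵖ w := by
    rw [Fintype.linearIndependent_iff] at hv ⊢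
    intro g hg j
    let e : Fin k → DualQuaternion := fun j => TrivSqZeroExt.inr (g j).unop
    have he : Uᴴ *ᵥ (fun i => ∑ j, v j i * e j) = 0 := by
      ext1 i
      have h1 : (Uᴴ *ᵥ (fun i => ∑ j, v j i * e j)) i = ∑ j, (Uᴴ *ᵥ v j) i * e j := by
        simp only [Matrix.mulVec, dotProduct, Finset.mul_sum, Finset.sum_mul, mul_assoc]
        exact Finset.sum_comm
      rw [h1]
      apply TrivSqZeroExt.ext
      · simp [TrivSqZeroExt.fst_sum, e]
      · simp only [TrivSqZeroExt.snd_sum, snd_mul_eq, e, TrivSqZeroExt.snd_inr,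
          TrivSqZeroExt.fst_inr, mul_zero, add_zero, Pi.zero_apply, TrivSqZeroExt.snd_zero]
        by_cases hi : σ i = d
        · have h2 := congrArg MulOpposite.unop (congrFun hg ⟨i, hi⟩)
          simpa [w] using h2
        · exact Finset.sum_eq_zero fun j _ => by
            rw [fst_eq_zero_of_ne hi ((hc j).2 i), zero_mul]
    have he' : (fun i => ∑ j, v j i * e j) = 0 := by
      rw [← Matrix.one_mulVec (fun i => ∑ j, v j i * e j), ← hU', ← Matrix.mulVec_mulVec, he,
        Matrix.mulVec_zero]
    have h3 := hv (fun j => MulOpposite.op (e j)) (by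
      rw [← he']
      ext1 i
      simp) j
    have h4 : e j = 0 := MulOpposite.op_injective h3
    exact MulOpposite.unop_injective (by simpa [e] using congrArg TrivSqZeroExt.snd h4)
  have h := hw.fintype_card_le_finrank
  rwa [Module.finrank_fintype_fun_eq_card, Fintype.card_fin, ← Nat.card_eq_fintype_card] at h

theorem hasMultiplicity_card (hU' : U * Uᴴ = 1)
    (hU : Uᴴ * U = 1) (hA : A * U = U * Matrix.diagonal fun i => ofDual (σ i)) (d : DualReal) :
    HasMultiplicity A d (Nat.card {i : Fin n // σ i = d}) := by
  refine ⟨?_, fun k ⟨v, hv, hvd⟩ => card_le_of_linearIndependent hU' hU hA hv hvd⟩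
  let e := (Finite.equivFin {i : Fin n // σ i = d}).symm
  refine ⟨fun j => U.col (e j), ?_, fun j => ?_⟩
  · exact (linearIndependent_col hU).comp (fun j => (e j : Fin n))
      (Subtype.val_injective.comp e.injective)
  · have h := isEigenvector_col hU hA (e j)
    rwa [(e j).2] at h

/-- The quadratic form becomes a weighted sum of squared magnitudes, from which both definiteness
criteria follow; the converse directions test it on the columns of `U`. -/
theorem star_dotProduct_mulVec_eq (hU' : U * Uᴴ = 1)
    (hA : A * U = U * Matrix.diagonal fun i => ofDual (σ i)) (x : Fin n → DualQuaternion) :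
    star x ⬝ᵥ (A *ᵥ x) = ofDual (∑ i, σ i * normSq ((Uᴴ *ᵥ x) i)) := by
  have h : A = U * (Matrix.diagonal fun i => ofDual (σ i)) * Uᴴ := by
    rw [← hA, Matrix.mul_assoc, hU', Matrix.mul_one]
  have h1 : star x ⬝ᵥ (A *ᵥ x) =
      star (Uᴴ *ᵥ x) ⬝ᵥ ((Matrix.diagonal fun i => ofDual (σ i)) *ᵥ (Uᴴ *ᵥ x)) := by
    rw [h, Matrix.star_mulVec, Matrix.conjTranspose_conjTranspose, ← Matrix.dotProduct_mulVec,
      Matrix.mulVec_mulVec, Matrix.mulVec_mulVec]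
  rw [h1, ofDual_sum, dotProduct]
  refine Finset.sum_congr rfl fun i _ => ?_
  rw [Matrix.mulVec_diagonal, ofDual_mul, ← star_mul_self_eq, ofDual_mul_comm, ofDual_mul_comm,
    mul_assoc, Pi.star_apply]

theorem star_col_dotProduct_mulVec_col (hU : Uᴴ * U = 1)
    (hA : A * U = U * Matrix.diagonal fun i => ofDual (σ i)) (i : Fin n) :
    star (U.col i) ⬝ᵥ (A *ᵥ U.col i) = ofDual (σ i) := by
  have h : (star (U.col i) ⬝ᵥ fun j => U.col i j * ofDual (σ i)) =
      (star (U.col i) ⬝ᵥ U.col i) * ofDual (σ i) := by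
    simp only [dotProduct, Finset.sum_mul, mul_assoc]
  rw [(isEigenvector_col hU hA i).2, h, star_col_dotProduct_col hU, if_pos rfl, one_mul]

theorem isPosSemidef_iff (hAh : A.IsHermitian) (hU' : U * Uᴴ = 1)
    (hU : Uᴴ * U = 1) (hA : A * U = U * Matrix.diagonal fun i => ofDual (σ i)) :
    IsPosSemidef A ↔ ∀ i, 0 ≤ σ i := by
  constructor
  · rintro ⟨-, h⟩ i
    obtain ⟨d, hd, hd0⟩ := h (U.col i)
    rw [star_col_dotProduct_mulVec_col hU hA] at hd
    rwa [ofDual_injective hd]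
  · exact fun h => ⟨hAh, fun x => ⟨_, star_dotProduct_mulVec_eq hU' hA x,
      DualReal.sum_nonneg _ fun i => DualReal.mul_nonneg (h i) (normSq_nonneg _)⟩⟩

theorem isPosDef_iff (hAh : A.IsHermitian) (hU' : U * Uᴴ = 1)
    (hU : Uᴴ * U = 1) (hA : A * U = U * Matrix.diagonal fun i => ofDual (σ i)) :
    IsPosDef A ↔ ∀ i, 0 < σ i ∧ (σ i).Appreciable := by
  constructor
  · rintro ⟨-, h⟩ i
    obtain ⟨d, hd, hd0⟩ := h (U.col i) (isEigenvector_col hU hA i).1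
    rw [star_col_dotProduct_mulVec_col hU hA] at hd
    rwa [ofDual_injective hd]
  · refine fun h => ⟨hAh, fun x hx => ⟨_, star_dotProduct_mulVec_eq hU' hA x, ?_⟩⟩
    -- Positive and appreciable means positive standard part, so only real numbers remain to be
    -- compared.
    simp only [DualReal.pos_and_appreciable_iff] at h ⊢
    have hc : AppreciableVec (Uᴴ *ᵥ x) := by
      refine .of_mulVec (M := U) ?_
      rwa [Matrix.mulVec_mulVec, hU', Matrix.one_mulVec]
    obtain ⟨i, hi⟩ := hc
    simp only [TrivSqZeroExt.fst_sum, TrivSqZeroExt.fst_mul, fst_normSq]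
    exact Finset.sum_pos'
      (fun j _ => _root_.mul_nonneg (h j).le Quaternion.normSq_nonneg)
      ⟨i, Finset.mem_univ i, mul_pos (h i)
        (lt_of_le_of_ne Quaternion.normSq_nonneg (Quaternion.normSq_ne_zero.2 hi).symm)⟩

end Diagonalized

end DualQuaternion

theorem theorem4p2 {n : ℕ} (A : Matrix (Fin n) (Fin n) DualQuaternion) (hA : A.IsHermitian) :
    ∃ σ : Fin n → DualReal,
      Antitone σ ∧
      (∀ l : DualQuaternion,
        DualQuaternion.IsRightEigenvalue A l ↔ ∃ i, l = DualQuaternion.ofDual (σ i)) ∧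
      (∀ d : DualReal, DualQuaternion.HasMultiplicity A d (Nat.card {i : Fin n // σ i = d})) ∧
      (∃ u : Fin n → (Fin n → DualQuaternion),
        (∀ i j, star (u i) ⬝ᵥ u j = if i = j then 1 else 0) ∧
        ∀ i, DualQuaternion.IsEigenvector A (σ i) (u i)) ∧
      (DualQuaternion.IsPosSemidef A ↔ ∀ i, 0 ≤ σ i) ∧
      (DualQuaternion.IsPosDef A ↔ ∀ i, 0 < σ i ∧ DualReal.Appreciable (σ i)) := by
  obtain ⟨U, σ, hσ, hU, hU', hAU⟩ := DualQuaternion.exists_antitone_unitary_mul_diagonal hA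
  exact ⟨σ, hσ, DualQuaternion.isRightEigenvalue_iff hU' hU hAU,
    DualQuaternion.hasMultiplicity_card hU' hU hAU,
    ⟨fun i => U.col i, DualQuaternion.star_col_dotProduct_col hU,
      DualQuaternion.isEigenvector_col hU hAU⟩,
    DualQuaternion.isPosSemidef_iff hA hU' hU hAU, DualQuaternion.isPosDef_iff hA hU' hU hAU⟩
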